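/- Let $\mathcal H,\mathcal H'$ be finite-dimensional complex Hilbert spaces, and write $\langle X,Y\rangle_{\rm HS}=\mathrm{tr}[X^\dagger Y]$. Let $f:(0,\infty)\to(0,\infty)$ be operator monotone, i.e. $f(A)\le f(B)$ for all positive-definite operators $A\le B$ on finite-dimensional Hilbert spaces of any dimension. For a positive-definite operator $\rho$ with spectral decomposition $\rho=\sum_i p_iP_i$ (distinct eigenvalues $p_i$) define the superoperators $$f(\mathcal D_{\rho,\rho})(X)=\sum_{i,j} f(p_i/p_j)\,P_iXP_j,\qquad \mathcal R_\rho(X)=X\rho,\qquad \mathcal K_\rho=f(\mathcal D_{\rho,\rho})\,\mathcal R_\rho ,$$ so that $f(\mathcal D_{\rho,\rho})$ is the function $f$ of the modular operator $\mathcal D_{\rho,\rho}(X)=\rho X\rho^{-1}$ and $\mathcal K_\rho$ is invertible. The quantum Fisher information metric is $G_\rho(X,Y)=\langle X,\mathcal K_\rho^{-1}(Y)\rangle_{\rm HS}$. For a smooth family $\theta\mapsto\rho(\theta)$ of positive-definite states, with $\theta$ in an open subset $\Theta\subseteq\mathbb R^m$, the quantum Fisher information matrix is the $m\times m$ matrix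 with entries $K_{\rho(\theta),kl}=G_{\rho(\theta)}(\partial_k\rho(\theta),\partial_l\rho(\theta))$. Let $\mathcal E:\mathcal L(\mathcal H)\to\mathcal L(\mathcal H')$ be a linear map that is trace-preserving and 2-positive (i.e. $\mathcal E\otimes\mathcal I_2$ maps positive semidefinite operators on $\mathcal H\otimes\mathbb C^2$ to positive semidefinite operators). 1. If $\rho$ and $\mathcal E(\rho)$ are positive-definite states (of trace one), then for every $X\in\mathcal L(\mathcal H)$ the numbers $G_\rho(X,X)$ and $G_{\mathcal E(\rho)}(\mathcal E(X),\mathcal E(X))$ are real and $$G_\rho(X,X)\ \ge\ G_{\mathcal E(\rho)}(\mathcal E(X),\mathcal E(X)).$$ 2. If $\rho(\theta)$, $\theta\in\Theta$, is a smooth family such that $\rho(\theta)$ and $\mathcal E(\rho(\theta))$ are positive-definite states for every $\theta\in\Theta$, then for every $\theta\in\Theta$ $$K_{\rho(\theta)}\ \ge\ K_{\mathcal E(\rho(\theta))},$$ i.e. the difference $K_{\rho(\theta)}-K_{\mathcal E(\rho(\theta))}$ is a positive semidefinite (Hermitian) matrix. -/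

import Mathlib

open Matrix
open scoped MatrixOrder ComplexOrder ContDiff Kronecker

noncomputable section

namespace QFisher

variable {n p : Type*} [Fintype n] [DecidableEq n] [Fintype p] [DecidableEq p]

/-- Operator monotonicity of a function on `(0, ∞)`: `f(X) ≤ f(Y)` in the Loewner order for
all positive-definite complex matrices `X ≤ Y` of any size. -/
def IsOperatorMonotone (f : ℝ → ℝ) : Prop :=
  ∀ (d : ℕ) (X Y : Matrix (Fin d) (Fin d) ℂ), X.PosDef → Y.PosDef → X ≤ Y → cfc f X ≤ cfc f Y

/-- A normalized positive-definite state (density matrix of full rank). -/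
def IsPosDefState (ρ : Matrix n n ℂ) : Prop := ρ.PosDef ∧ ρ.trace = 1

/-- The superoperator `ℰ ⊗ ℐ_k` on matrices indexed by `n × Fin k`: `ℰ` acts on each of the
`k × k` blocks. -/
def ampliation (k : ℕ) (E : Matrix n n ℂ →ₗ[ℂ] Matrix p p ℂ) :
    Matrix (n × Fin k) (n × Fin k) ℂ →ₗ[ℂ] Matrix (p × Fin k) (p × Fin k) ℂ where
  toFun X := Matrix.of fun i j => E (Matrix.of fun a b => X (a, i.2) (b, j.2)) i.1 j.1
  map_add' X Y := by
    ext i j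
    exact congrFun (congrFun (E.map_add (Matrix.of fun a b => X (a, i.2) (b, j.2))
      (Matrix.of fun a b => Y (a, i.2) (b, j.2))) i.1) j.1
  map_smul' c X := by
    ext i j
    exact congrFun (congrFun (E.map_smul c (Matrix.of fun a b => X (a, i.2) (b, j.2))) i.1) j.1

set_option linter.unusedSectionVars false in
/-- `ampliation k E` is the tensor product of `E` with the identity. -/
theorem ampliation_kronecker (k : ℕ) (E : Matrix n n ℂ →ₗ[ℂ] Matrix p p ℂ)
    (A : Matrix n n ℂ) (B : Matrix (Fin k) (Fin k) ℂ) :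
    ampliation k E (A ⊗ₖ B) = E A ⊗ₖ B := by
  ext i j
  have h : (Matrix.of fun a b => (A ⊗ₖ B) (a, i.2) (b, j.2)) = B i.2 j.2 • A := by
    ext a b
    simp [mul_comm]
  change E (Matrix.of fun a b => (A ⊗ₖ B) (a, i.2) (b, j.2)) i.1 j.1 = _
  rw [h, map_smul]
  simp [mul_comm]

/-- `ℰ` is `k`-positive: `ℰ ⊗ ℐ_k` maps positive semidefinite matrices to positive
semidefinite matrices. -/
def IsNPositive (k : ℕ) (E : Matrix n n ℂ →ₗ[ℂ] Matrix p p ℂ) : Prop :=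
  ∀ X : Matrix (n × Fin k) (n × Fin k) ℂ, X.PosSemidef → (ampliation k E X).PosSemidef

/-- `ℰ` is trace-preserving. -/
def IsTracePreserving (E : Matrix n n ℂ →ₗ[ℂ] Matrix p p ℂ) : Prop :=
  ∀ X : Matrix n n ℂ, (E X).trace = X.trace

/-- The Hilbert–Schmidt inner product `tr[X† Y]`. -/
def hsInner (X Y : Matrix n n ℂ) : ℂ := (Xᴴ * Y).trace

/-- For Hermitian `A`, the orthogonal projector onto the eigenspace of `A` for the
eigenvalue `x`. -/
def spectralProj (A : Matrix n n ℂ) (x : ℝ) : Matrix n n ℂ :=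
  cfc (Set.indicator {x} (1 : ℝ → ℝ)) A

/-- The finite set of (distinct) real eigenvalues. -/
def realSpectrum (A : Matrix n n ℂ) : Finset ℝ := (Matrix.finite_real_spectrum (A := A)).toFinset

theorem spectralProj_mul (A : Matrix n n ℂ) (x y : ℝ) :
    spectralProj A x * spectralProj A y = if x = y then spectralProj A x else 0 := by
  have hc : ∀ g : ℝ → ℝ, ContinuousOn g (spectrum ℝ A) := fun g =>
    (Matrix.finite_real_spectrum (A := A)).continuousOn g
  unfold spectralProj
  rw [← cfc_mul _ _ A (hc _) (hc _)]
  split_ifs with h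
  · subst h
    congr 1
    funext t
    by_cases ht : t = x <;> simp [ht]
  · rw [← cfc_zero ℝ A]
    congr 1
    funext t
    by_cases ht : t = x
    · subst ht; simp [h]
    · simp [ht]

/-- For Hermitian `A` and `g = id` this is the spectral decomposition `A = ∑ x P_x`. -/
theorem sum_smul_spectralProj (A : Matrix n n ℂ) (g : ℝ → ℝ) :
    ∑ x ∈ realSpectrum A, g x • spectralProj A x = cfc g A := by
  have hc : ∀ g : ℝ → ℝ, ContinuousOn g (spectrum ℝ A) := fun g =>
    (Matrix.finite_real_spectrum (A := A)).continuousOn g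
  have h1 : ∀ x ∈ realSpectrum A, g x • spectralProj A x
      = cfc (fun t => g x • Set.indicator {x} (1 : ℝ → ℝ) t) A := fun x _ =>
    (cfc_smul (g x) _ A (hc _)).symm
  rw [Finset.sum_congr rfl h1, ← cfc_sum _ A _ (fun _ _ => hc _)]
  refine cfc_congr fun t ht => ?_
  have ht' : t ∈ realSpectrum A := by simpa [realSpectrum] using ht
  rw [Finset.sum_apply, Finset.sum_eq_single_of_mem t ht']
  · simp
  · intro b _ hb
    simp [Ne.symm hb]

/-- The function `f(𝒟_{ρ,σ})` of the modular operator `𝒟_{ρ,σ}(X) = ρ X σ⁻¹`: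
`f(𝒟_{ρ,σ})(X) = ∑_{i,j} f(p_i / q_j) P_i X Q_j`, where `ρ = ∑ p_i P_i` and `σ = ∑ q_j Q_j` are
the spectral decompositions with distinct eigenvalues. -/
def modularFun (f : ℝ → ℝ) (ρ σ : Matrix n n ℂ) : Module.End ℂ (Matrix n n ℂ) :=
  ∑ x ∈ realSpectrum ρ, ∑ y ∈ realSpectrum σ,
    ((f (x / y) : ℝ) : ℂ) • (LinearMap.mulLeft ℂ (spectralProj ρ x) ∘ₗ
      LinearMap.mulRight ℂ (spectralProj σ y))

/-- `𝒦_ρ = f(𝒟_{ρ,ρ}) ℛ_ρ`, where `ℛ_ρ(X) = X ρ`. -/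
def fisherOp (f : ℝ → ℝ) (ρ : Matrix n n ℂ) : Module.End ℂ (Matrix n n ℂ) :=
  modularFun f ρ ρ * LinearMap.mulRight ℂ ρ

theorem modularFun_apply (f : ℝ → ℝ) (ρ σ X : Matrix n n ℂ) :
    modularFun f ρ σ X = ∑ x ∈ realSpectrum ρ, ∑ y ∈ realSpectrum σ,
      ((f (x / y) : ℝ) : ℂ) • (spectralProj ρ x * X * spectralProj σ y) := by
  simp [modularFun, LinearMap.sum_apply, Matrix.mul_assoc]

theorem isUnit_fisherOp {f : ℝ → ℝ} (hf : ∀ x : ℝ, 0 < x → 0 < f x) {ρ : Matrix n n ℂ}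
    (hρ : ρ.PosDef) : IsUnit (fisherOp f ρ) := by
  have hH : ρ.IsHermitian := hρ.1
  have hpos : ∀ x ∈ realSpectrum ρ, 0 < x := by
    intro x hx
    have hx' : x ∈ spectrum ℝ ρ := by simpa [realSpectrum] using hx
    rw [hH.spectrum_real_eq_range_eigenvalues] at hx'
    obtain ⟨i, rfl⟩ := hx'
    exact hρ.eigenvalues_pos i
  have hone : ∑ x ∈ realSpectrum ρ, spectralProj ρ x = 1 := by
    have h := sum_smul_spectralProj ρ (fun _ => 1)
    have hsa : IsSelfAdjoint ρ := hH
    rw [cfc_const_one ℝ ρ hsa] at h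
    simpa using h
  refine IsUnit.mul ?_ ?_
  · rw [LinearMap.isUnit_iff_ker_eq_bot, LinearMap.ker_eq_bot']
    intro X hX
    have key : ∀ a ∈ realSpectrum ρ, ∀ b ∈ realSpectrum ρ,
        spectralProj ρ a * X * spectralProj ρ b = 0 := by
      intro a ha b hb
      have h : spectralProj ρ a * modularFun f ρ ρ X * spectralProj ρ b = 0 := by simp [hX]
      rw [modularFun_apply, Finset.mul_sum, Finset.sum_mul, Finset.sum_eq_single_of_mem a ha,
        Finset.mul_sum, Finset.sum_mul, Finset.sum_eq_single_of_mem b hb] at h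
      · have e : spectralProj ρ a * (((f (a / b) : ℝ) : ℂ) •
            (spectralProj ρ a * X * spectralProj ρ b)) * spectralProj ρ b
            = ((f (a / b) : ℝ) : ℂ) • ((spectralProj ρ a * spectralProj ρ a) * X *
              (spectralProj ρ b * spectralProj ρ b)) := by
          simp [Matrix.mul_assoc]
        rw [e, spectralProj_mul, spectralProj_mul, if_pos rfl, if_pos rfl] at h
        refine (smul_eq_zero.mp h).resolve_left ?_
        exact_mod_cast (hf _ (div_pos (hpos a ha) (hpos b hb))).ne'
      · intro y _ hy
        have : spectralProj ρ y * spectralProj ρ b = 0 := by rw [spectralProj_mul, if_neg hy]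
        simp [Matrix.mul_assoc, this]
      · intro x _ hx
        have : spectralProj ρ a * spectralProj ρ x = 0 := by
          rw [spectralProj_mul, if_neg (Ne.symm hx)]
        rw [Finset.mul_sum, Finset.sum_mul]
        refine Finset.sum_eq_zero fun y _ => ?_
        simp [← Matrix.mul_assoc, this]
    calc X = (∑ x ∈ realSpectrum ρ, spectralProj ρ x) * X *
          (∑ y ∈ realSpectrum ρ, spectralProj ρ y) := by rw [hone]; simp
      _ = 0 := by
        rw [Finset.sum_mul, Finset.sum_mul]
        refine Finset.sum_eq_zero fun a ha => ?_
        rw [Finset.mul_sum]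
        exact Finset.sum_eq_zero fun b hb => key a ha b hb
  · rw [LinearMap.isUnit_iff_ker_eq_bot, LinearMap.ker_eq_bot']
    intro X hX
    have h : X * ρ = 0 := hX
    exact (hρ.isUnit.mul_left_eq_zero).mp h

/-- The quantum Fisher information metric `G_ρ(X, Y) = ⟨X, 𝒦_ρ⁻¹(Y)⟩_HS`. The superoperator
`𝒦_ρ` is invertible for positive-definite `ρ` and `f > 0`, see `isUnit_fisherOp`. -/
def fisherMetric (f : ℝ → ℝ) (ρ X Y : Matrix n n ℂ) : ℂ :=
  hsInner X (Ring.inverse (fisherOp f ρ) Y)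

/-- The partial derivative `∂_k ρ(θ)` of a matrix-valued function, taken entrywise. -/
def partialDeriv {m : ℕ} (ρ : (Fin m → ℝ) → Matrix n n ℂ) (k : Fin m) (θ : Fin m → ℝ) :
    Matrix n n ℂ :=
  Matrix.of fun i j => fderiv ℝ (fun t => ρ t i j) θ (Pi.single k 1)

/-- The quantum Fisher information matrix `K_{ρ(θ),kl} = ⟨∂_k ρ(θ), 𝒦_{ρ(θ)}⁻¹(∂_l ρ(θ))⟩_HS`. -/
def fisherMatrix {m : ℕ} (f : ℝ → ℝ) (ρ : (Fin m → ℝ) → Matrix n n ℂ) (θ : Fin m → ℝ) :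
    Matrix (Fin m) (Fin m) ℂ :=
  Matrix.of fun k l => fisherMetric f (ρ θ) (partialDeriv ρ k θ) (partialDeriv ρ l θ)

/-- Smoothness of a matrix-valued function on a set, entrywise. -/
def IsSmoothOn {m : ℕ} (ρ : (Fin m → ℝ) → Matrix n n ℂ) (Θ : Set (Fin m → ℝ)) : Prop :=
  ∀ i j, ContDiffOn ℝ ∞ (fun t => ρ t i j) Θ

end QFisher

end

open QFisher

noncomputable section

namespace QFisher

/-! ### Functional calculus through resolutions of the identity. -/

section FunctionalCalculus

variable {m k : Type*} [Fintype m] [DecidableEq m] [Fintype k] [DecidableEq k]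

/-! Vectorization turns superoperators into matrices. Put `S` for right multiplication by `√ρ` and
`D` for the modular operator, so that `S * S` is `ℛ_ρ`, `S * D * S` is left multiplication `ℒ_ρ`,
and `𝒦_ρ = S f(D) S` is an operator mean of the two. A Schur complement (`conj_le_iff_conj_inv_le`)
turns the wanted `ℰ† 𝒦_{ℰ(ρ)}⁻¹ ℰ ≤ 𝒦_ρ⁻¹` into `ℰ 𝒦_ρ ℰ† ≤ 𝒦_{ℰ(ρ)}`.

The transformer inequality `IsOperatorMonotone.transformer_le` reduces this to the same inequality
for `ℛ` and for `ℒ`. Dualized back, both say `tr[ℰ(X)† ℰ(ρ)⁻¹ ℰ(X)] ≤ tr[X† ρ⁻¹ X]`, for `X` or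
`X†`; this is the Lieb–Ruskai Schwarz inequality under the trace (`IsNPositive.trace_schwarz`).

The transformer inequality rests on Hansen's inequality `IsOperatorMonotone.contraction_le`,
obtained from monotonicity by dilating a contraction to an isometry. -/

theorem continuousOn_spectrum (A : Matrix m m ℂ) (g : ℝ → ℝ) :
    ContinuousOn g (spectrum ℝ A) :=
  (Matrix.finite_real_spectrum (A := A)).continuousOn g

theorem exists_polynomial_eqOn (f : ℝ → ℝ) (s : Finset ℝ) :
    ∃ q : Polynomial ℝ, ∀ x ∈ s, q.eval x = f x :=
  ⟨Lagrange.interpolate s id f, fun _ hx =>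
    Lagrange.eval_interpolate_at_node f Function.injective_id.injOn hx⟩

theorem aeval_sum_smul {ι : Type*} [DecidableEq ι] (s : Finset ι) (c : ι → ℝ)
    (P : ι → Matrix m m ℂ) (hmul : ∀ i ∈ s, ∀ j ∈ s, P i * P j = if i = j then P i else 0)
    (hsum : ∑ i ∈ s, P i = 1) (q : Polynomial ℝ) :
    Polynomial.aeval (∑ i ∈ s, c i • P i) q = ∑ i ∈ s, q.eval (c i) • P i := by
  have hpow : ∀ d : ℕ, (∑ i ∈ s, c i • P i) ^ d = ∑ i ∈ s, c i ^ d • P i := by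
    intro d
    induction d with
    | zero => simp [hsum]
    | succ d ih =>
      rw [pow_succ, ih, Finset.sum_mul]
      refine Finset.sum_congr rfl fun i hi => ?_
      rw [Finset.mul_sum, Finset.sum_eq_single_of_mem i hi]
      · rw [smul_mul_smul_comm, hmul i hi i hi, if_pos rfl, pow_succ]
      · intro j hj hji
        rw [smul_mul_smul_comm, hmul i hi j hj, if_neg hji.symm, smul_zero]
  induction q using Polynomial.induction_on' with
  | add p q hp hq => simp [hp, hq, add_smul, Finset.sum_add_distrib]
  | monomial d a =>
    rw [Polynomial.aeval_monomial, hpow, Finset.mul_sum]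
    refine Finset.sum_congr rfl fun i _ => ?_
    rw [Polynomial.eval_monomial, mul_smul, Algebra.algebraMap_eq_smul_one, smul_one_mul]

/-- The functional calculus of an operator given by a resolution of the identity. -/
theorem cfc_sum_smul {ι : Type*} [DecidableEq ι] (f : ℝ → ℝ) (s : Finset ι) (c : ι → ℝ)
    (P : ι → Matrix m m ℂ) (hP : ∀ i ∈ s, (P i).IsHermitian)
    (hmul : ∀ i ∈ s, ∀ j ∈ s, P i * P j = if i = j then P i else 0)
    (hsum : ∑ i ∈ s, P i = 1) :
    cfc f (∑ i ∈ s, c i • P i) = ∑ i ∈ s, f (c i) • P i := by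
  set T := ∑ i ∈ s, c i • P i with hT
  have hsa : IsSelfAdjoint T := by
    refine isSelfAdjoint_sum s fun i hi => ?_
    exact (IsSelfAdjoint.all (c i)).smul (hP i hi)
  -- If `P i = 0`, the value `c i` need not be an eigenvalue of `T`, hence the union. Interpolating
  -- on a finite set needs no continuity of `f`.
  obtain ⟨q, hq⟩ := exists_polynomial_eqOn f (realSpectrum T ∪ s.image c)
  have h1 : cfc f T = Polynomial.aeval T q := by
    rw [← cfc_polynomial q T hsa]
    refine cfc_congr fun x hx => (hq x ?_).symm
    exact Finset.mem_union_left _ (by simpa [realSpectrum] using hx)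
  rw [h1, hT, aeval_sum_smul s c P hmul hsum]
  refine Finset.sum_congr rfl fun i hi => ?_
  rw [hq _ (Finset.mem_union_right _ (Finset.mem_image_of_mem c hi))]

theorem sum_spectralProj {A : Matrix m m ℂ} (hA : A.IsHermitian) :
    ∑ x ∈ realSpectrum A, spectralProj A x = 1 := by
  have h := sum_smul_spectralProj A (fun _ => 1)
  have hsa : IsSelfAdjoint A := hA
  rw [cfc_const_one ℝ A hsa] at h
  simpa using h

theorem sum_smul_spectralProj_self {A : Matrix m m ℂ} (hA : A.IsHermitian) :
    ∑ x ∈ realSpectrum A, x • spectralProj A x = A := by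
  have h := sum_smul_spectralProj A (fun x => x)
  have hsa : IsSelfAdjoint A := hA
  rwa [cfc_id' ℝ A hsa] at h

theorem isHermitian_cfc (f : ℝ → ℝ) (A : Matrix m m ℂ) : (cfc f A).IsHermitian :=
  cfc_predicate f A

theorem isHermitian_spectralProj (A : Matrix m m ℂ) (x : ℝ) : (spectralProj A x).IsHermitian :=
  isHermitian_cfc _ A

theorem pos_of_mem_realSpectrum {A : Matrix m m ℂ} (hA : A.PosDef) {x : ℝ}
    (hx : x ∈ realSpectrum A) : 0 < x := by
  have hx' : x ∈ spectrum ℝ A := by simpa [realSpectrum] using hx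
  rw [hA.1.spectrum_real_eq_range_eigenvalues] at hx'
  obtain ⟨i, rfl⟩ := hx'
  exact hA.eigenvalues_pos i

theorem posDef_cfc {f : ℝ → ℝ} {A : Matrix m m ℂ} (hA : A.PosDef)
    (hf : ∀ x : ℝ, 0 < x → 0 < f x) : (cfc f A).PosDef := by
  have hpos : ∀ x ∈ spectrum ℝ A, 0 < f x := fun x hx =>
    hf x (pos_of_mem_realSpectrum hA (by simpa [realSpectrum] using hx))
  have hsa : IsSelfAdjoint A := hA.1
  refine ((Matrix.nonneg_iff_posSemidef.mp (cfc_nonneg fun x hx => (hpos x hx).le)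
    ).posDef_iff_isUnit).mpr ?_
  exact (isUnit_cfc_iff f A (continuousOn_spectrum A f) hsa).mpr fun x hx => (hpos x hx).ne'

/-- Functional calculus of `W B W† + c (1 - W W†)` for an isometry `W`. -/
theorem cfc_isometry_conj (f : ℝ → ℝ) {W : Matrix k m ℂ} (hW : Wᴴ * W = 1)
    {B : Matrix m m ℂ} (hB : B.IsHermitian) (c : ℝ) :
    cfc f (W * B * Wᴴ + c • (1 - W * Wᴴ)) = W * cfc f B * Wᴴ + f c • (1 - W * Wᴴ) := by
  -- `none` labels the complement of the range of `W`. The value `c` may coincide with an eigenvalue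
  -- of `B`, since `cfc_sum_smul` allows repeated values.
  let P : Option ℝ → Matrix k k ℂ := fun o => o.elim (1 - W * Wᴴ) fun x =>
    W * spectralProj B x * Wᴴ
  let d : Option ℝ → ℝ := fun o => o.elim c id
  have hW' : ∀ Z : Matrix m k ℂ, Wᴴ * (W * Z) = Z := fun Z => by
    rw [← Matrix.mul_assoc, hW, Matrix.one_mul]
  have key : ∀ g : ℝ → ℝ, ∑ o ∈ Finset.insertNone (realSpectrum B), g (d o) • P o
      = W * cfc g B * Wᴴ + g c • (1 - W * Wᴴ) := by
    intro g
    rw [Finset.sum_insertNone, ← sum_smul_spectralProj B g, Matrix.mul_sum, Matrix.sum_mul,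
      add_comm]
    simp [P, d]
  have hone : ∑ o ∈ Finset.insertNone (realSpectrum B), P o = 1 := by
    have h := key fun _ => 1
    have hsa : IsSelfAdjoint B := hB
    rw [cfc_const_one ℝ B hsa] at h
    simpa using h
  have hT : W * B * Wᴴ + c • (1 - W * Wᴴ)
      = ∑ o ∈ Finset.insertNone (realSpectrum B), d o • P o := by
    have h := key fun x => x
    have hsa : IsSelfAdjoint B := hB
    rw [cfc_id' ℝ B hsa] at h
    exact h.symm
  rw [hT, cfc_sum_smul f _ d P _ _ hone, key f]
  · intro o _
    cases o with
    | none => exact Matrix.isHermitian_one.sub (Matrix.isHermitian_mul_conjTranspose_self W)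
    | some x => exact Matrix.isHermitian_mul_mul_conjTranspose W (isHermitian_spectralProj B x)
  · intro o _ o' _
    rcases o with _ | x <;> rcases o' with _ | y
    · simp [P, Matrix.mul_sub, Matrix.sub_mul, Matrix.mul_assoc, hW']
    · simp [P, Matrix.sub_mul, Matrix.mul_assoc, hW']
    · simp [P, Matrix.mul_sub, Matrix.mul_assoc, hW']
    · have h := spectralProj_mul B x y
      have : W * spectralProj B x * Wᴴ * (W * spectralProj B y * Wᴴ)
          = W * (spectralProj B x * spectralProj B y) * Wᴴ := by
        simp only [Matrix.mul_assoc, hW']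
      simp only [P, Option.elim, this, h, Option.some.injEq]
      split_ifs <;> simp

end FunctionalCalculus

/-! ### Loewner-order estimates. -/

section Order

variable {m k : Type*} [Fintype m] [DecidableEq m] [Fintype k] [DecidableEq k]

theorem exists_le_smul_one_of_isHermitian {A : Matrix m m ℂ} (hA : A.IsHermitian) :
    ∃ c : ℝ, 0 < c ∧ (c • (1 : Matrix m m ℂ) - A).PosSemidef := by
  obtain ⟨c, hc⟩ := (realSpectrum A).bddAbove
  refine ⟨max c 1, by positivity, ?_⟩
  have hsa : IsSelfAdjoint A := hA
  have h : A ≤ algebraMap ℝ _ (max c 1) := le_algebraMap_of_spectrum_le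
    (fun x hx => (hc (by simpa [realSpectrum] using hx)).trans (le_max_left _ _)) hsa
  rwa [Algebra.algebraMap_eq_smul_one, Matrix.le_iff] at h

theorem exists_smul_one_le_of_posDef {A : Matrix m m ℂ} (hA : A.PosDef) :
    ∃ c : ℝ, 0 < c ∧ (A - c • (1 : Matrix m m ℂ)).PosSemidef := by
  have hsa : IsSelfAdjoint A := hA.1
  obtain ⟨c, hc0, hc⟩ : ∃ c : ℝ, 0 < c ∧ ∀ x ∈ realSpectrum A, c ≤ x := by
    rcases (realSpectrum A).eq_empty_or_nonempty with h | h
    · exact ⟨1, one_pos, by simp [h]⟩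
    · exact ⟨(realSpectrum A).min' h, pos_of_mem_realSpectrum hA (Finset.min'_mem _ h),
        fun x hx => Finset.min'_le _ x hx⟩
  refine ⟨c, hc0, ?_⟩
  have h : algebraMap ℝ _ c ≤ A := algebraMap_le_of_le_spectrum
    (fun x hx => hc x (by simpa [realSpectrum] using hx)) hsa
  rwa [Algebra.algebraMap_eq_smul_one, Matrix.le_iff] at h

omit [Fintype m] in
theorem posDef_smul_one {c : ℝ} (hc : 0 < c) : (c • (1 : Matrix m m ℂ)).PosDef :=
  Matrix.PosDef.one.smul hc

theorem exists_posDef_sub_smul {A H : Matrix m m ℂ} (hA : A.PosDef) (hH : H.IsHermitian) :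
    ∃ ε : ℝ, 0 < ε ∧ (A - ε • H).PosDef := by
  obtain ⟨c, hc, hcA⟩ := exists_smul_one_le_of_posDef hA
  obtain ⟨d, hd, hdH⟩ := exists_le_smul_one_of_isHermitian hH
  -- From `A ≥ c` and `H ≤ d`, subtracting `c / (2 * d)` times `H` leaves at least `c / 2`.
  refine ⟨c / (2 * d), by positivity, ?_⟩
  have e : A - (c / (2 * d)) • H = (c / 2) • (1 : Matrix m m ℂ) + ((A - c • 1)
      + (c / (2 * d)) • (d • (1 : Matrix m m ℂ) - H)) := by
    rw [smul_sub, smul_smul, show c / (2 * d) * d = c / 2 by field_simp]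
    module
  rw [e]
  exact (posDef_smul_one (by positivity)).add_posSemidef
    (hcA.add (hdH.smul (by positivity : (0 : ℝ) ≤ c / (2 * d))))

theorem posDef_isometry_conj {W : Matrix k m ℂ} (hW : Wᴴ * W = 1)
    {B : Matrix m m ℂ} (hB : B.PosDef) {c : ℝ} (hc : 0 < c) :
    (W * B * Wᴴ + c • (1 - W * Wᴴ)).PosDef := by
  obtain ⟨d, hd, hdB⟩ := exists_smul_one_le_of_posDef hB
  have hQ : (1 - W * Wᴴ).PosSemidef := by
    have h : 1 - W * Wᴴ = (1 - W * Wᴴ)ᴴ * (1 - W * Wᴴ) := by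
      have : Wᴴ * (W * Wᴴ) = Wᴴ := by rw [← Matrix.mul_assoc, hW, Matrix.one_mul]
      simp [Matrix.mul_sub, Matrix.sub_mul, Matrix.mul_assoc, this]
    rw [h]
    exact Matrix.posSemidef_conjTranspose_mul_self _
  have hP : (W * Wᴴ).PosSemidef := Matrix.posSemidef_self_mul_conjTranspose W
  have e : W * B * Wᴴ + c • (1 - W * Wᴴ) = (min c d) • (1 : Matrix k k ℂ) +
      (W * (B - d • (1 : Matrix m m ℂ)) * Wᴴ + ((c - min c d) • (1 - W * Wᴴ)
        + (d - min c d) • (W * Wᴴ))) := by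
    simp only [Matrix.mul_sub, Matrix.sub_mul, Matrix.mul_smul, Matrix.smul_mul, Matrix.mul_one]
    module
  rw [e]
  exact (posDef_smul_one (lt_min hc hd)).add_posSemidef
    ((hdB.mul_mul_conjTranspose_same W).add
      ((hQ.smul (sub_nonneg.mpr (min_le_left c d))).add
        (hP.smul (sub_nonneg.mpr (min_le_right c d)))))

/-- If the compression of `A` along an isometry `W` is strictly below `B`, then `A` is dominated
by `B` on the range of `W` plus a large multiple of the complementary projection. -/
theorem exists_le_isometry_conj {W : Matrix k m ℂ} (hW : Wᴴ * W = 1)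
    {A : Matrix k k ℂ} (hA : A.IsHermitian) {B : Matrix m m ℂ} (hBA : (B - Wᴴ * A * W).PosDef) :
    ∃ c : ℝ, 0 < c ∧ A ≤ W * B * Wᴴ + c • (1 - W * Wᴴ) := by
  obtain ⟨δ, hδ, hδB⟩ := exists_smul_one_le_of_posDef hBA
  set P := W * Wᴴ with hP
  set Q := 1 - P with hQ
  have hPH : Pᴴ = P := by simp [hP]
  have hQH : Qᴴ = Q := by simp [hQ, hPH]
  have hPP : P * P = P := by
    rw [hP, Matrix.mul_assoc, ← Matrix.mul_assoc Wᴴ, hW, Matrix.one_mul]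
  -- A bound `c` on this operator controls what remains on the range of `Q` after completing the
  -- square.
  have hH : (A + δ⁻¹ • (A * P * A)).IsHermitian := by
    refine hA.add ?_
    have : (A * P * A).IsHermitian := by
      simp [Matrix.IsHermitian, hA.eq, hPH, Matrix.mul_assoc]
    exact IsSelfAdjoint.smul (IsSelfAdjoint.all _) this
  obtain ⟨c, hc, hcA⟩ := exists_le_smul_one_of_isHermitian hH
  refine ⟨c, hc, ?_⟩
  rw [Matrix.le_iff]
  -- Completing the square: the slack `δ • P` absorbs the off-diagonal blocks `P * A * Q` and `Q * A
  -- * P`, at the cost of `δ⁻¹ • (Q * A * P * A * Q)`.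
  have e : W * B * Wᴴ + c • Q - A = W * (B - Wᴴ * A * W - δ • (1 : Matrix m m ℂ)) * Wᴴ
      + (δ • ((P - δ⁻¹ • (P * A * Q))ᴴ * (P - δ⁻¹ • (P * A * Q)))
        + Qᴴ * (c • (1 : Matrix k k ℂ) - (A + δ⁻¹ • (A * P * A))) * Q) := by
    have e1 : W * (B - Wᴴ * A * W - δ • (1 : Matrix m m ℂ)) * Wᴴ
        = W * B * Wᴴ - P * A * P - δ • P := by
      simp [hP, Matrix.mul_sub, Matrix.sub_mul, Matrix.mul_assoc]
    have e2 : (P - δ⁻¹ • (P * A * Q))ᴴ * (P - δ⁻¹ • (P * A * Q))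
        = P - δ⁻¹ • (P * A * Q) - δ⁻¹ • (Q * A * P) + (δ⁻¹ * δ⁻¹) • (Q * A * P * A * Q) := by
      have hPX : ∀ X : Matrix k k ℂ, P * (P * X) = P * X := fun X => by
        rw [← Matrix.mul_assoc, hPP]
      simp only [Matrix.conjTranspose_sub, Matrix.conjTranspose_smul, Matrix.conjTranspose_mul,
        hPH, hQH, hA.eq, star_trivial, Matrix.mul_sub, Matrix.sub_mul, Matrix.mul_smul,
        Matrix.smul_mul, Matrix.mul_assoc, hPP, hPX]
      module
    have e3 : Qᴴ * (c • (1 : Matrix k k ℂ) - (A + δ⁻¹ • (A * P * A))) * Q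
        = c • Q - Q * A * Q - δ⁻¹ • (Q * A * P * A * Q) := by
      have hQQ : Q * Q = Q := by
        simp [hQ, Matrix.mul_sub, Matrix.sub_mul, hPP]
      simp only [hQH, Matrix.mul_sub, Matrix.sub_mul, Matrix.mul_add, Matrix.add_mul,
        Matrix.mul_smul, Matrix.smul_mul, Matrix.mul_one, hQQ, Matrix.mul_assoc]
      module
    have e4 : A = P * A * P + P * A * Q + Q * A * P + Q * A * Q := by
      simp only [hQ, Matrix.mul_sub, Matrix.sub_mul, Matrix.mul_one, Matrix.one_mul]
      abel
    rw [e1, e2, e3]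
    conv_lhs => rw [e4]
    simp only [smul_sub, smul_add, smul_smul, mul_inv_cancel_left₀ hδ.ne', mul_inv_cancel₀ hδ.ne']
    module
  rw [e]
  exact (hδB.mul_mul_conjTranspose_same W).add
    (((Matrix.posSemidef_conjTranspose_mul_self _).smul hδ.le).add
      (hcA.conjTranspose_mul_mul_same Q))

end Order

/-! ### From operator monotonicity to Hansen's inequality. -/

section OperatorMonotone

variable {m k : Type*} [Fintype m] [DecidableEq m] [Fintype k] [DecidableEq k]
variable {f : ℝ → ℝ}

omit [DecidableEq m] [DecidableEq k] in
theorem conj_mono {A B : Matrix m m ℂ} (h : A ≤ B) (C : Matrix k m ℂ) :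
    C * A * Cᴴ ≤ C * B * Cᴴ := by
  rw [Matrix.le_iff] at h ⊢
  rw [← Matrix.sub_mul, ← Matrix.mul_sub]
  exact h.mul_mul_conjTranspose_same C

omit [DecidableEq m] [DecidableEq k] in
theorem conj_mono' {A B : Matrix m m ℂ} (h : A ≤ B) (C : Matrix m k ℂ) :
    Cᴴ * A * C ≤ Cᴴ * B * C := by
  simpa using conj_mono h Cᴴ

/-- Passes from `Fin d` to arbitrary finite index types: relabelling is conjugation by a unitary
`W`, so the complement `1 - W * Wᴴ` vanishes. -/
theorem IsOperatorMonotone.cfc_le (hf : IsOperatorMonotone f) {X Y : Matrix m m ℂ}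
    (hX : X.PosDef) (hY : Y.PosDef) (hXY : X ≤ Y) : cfc f X ≤ cfc f Y := by
  let e := Fintype.equivFin m
  let W : Matrix (Fin (Fintype.card m)) m ℂ := (1 : Matrix m m ℂ).submatrix e.symm id
  have hWH : Wᴴ = (1 : Matrix m m ℂ).submatrix id e.symm := by
    simp [W, Matrix.conjTranspose_submatrix]
  have hW : Wᴴ * W = 1 := by
    rw [hWH]
    simp [W, Matrix.submatrix_mul_equiv]
  have hW' : W * Wᴴ = 1 := by
    rw [hWH, ← Matrix.submatrix_mul _ _ e.symm id e.symm Function.bijective_id]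
    simp
  have hcfc : ∀ {Z : Matrix m m ℂ}, Z.PosDef → cfc f (W * Z * Wᴴ) = W * cfc f Z * Wᴴ := by
    intro Z hZ
    simpa [hW'] using cfc_isometry_conj f hW hZ.1 1
  have hpd : ∀ {Z : Matrix m m ℂ}, Z.PosDef → (W * Z * Wᴴ).PosDef := by
    intro Z hZ
    simpa [hW'] using posDef_isometry_conj hW hZ one_pos
  have h := hf _ _ _ (hpd hX) (hpd hY) (conj_mono hXY W)
  rw [hcfc hX, hcfc hY] at h
  have hb : ∀ Z : Matrix m m ℂ, Wᴴ * (W * Z * Wᴴ) * W = Z := fun Z => by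
    calc Wᴴ * (W * Z * Wᴴ) * W = (Wᴴ * W) * Z * (Wᴴ * W) := by simp only [Matrix.mul_assoc]
      _ = Z := by simp [hW]
  simpa only [hb] using conj_mono' h W

/-- Apply `f` to the domination of `exists_le_isometry_conj` and compress by `W`: the term `f c • (1
- W * Wᴴ)` disappears, so the size of `c` is harmless. -/
theorem IsOperatorMonotone.isometry_le (hf : IsOperatorMonotone f) {W : Matrix k m ℂ}
    (hW : Wᴴ * W = 1) {A : Matrix k k ℂ} (hA : A.PosDef) {B : Matrix m m ℂ} (hB : B.PosDef)
    (hBA : (B - Wᴴ * A * W).PosDef) : Wᴴ * cfc f A * W ≤ cfc f B := by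
  obtain ⟨c, hc, hle⟩ := exists_le_isometry_conj hW hA.1 hBA
  have h := hf.cfc_le hA (posDef_isometry_conj hW hB hc) hle
  rw [cfc_isometry_conj f hW hB.1 c] at h
  have e : Wᴴ * (W * cfc f B * Wᴴ + f c • (1 - W * Wᴴ)) * W = cfc f B := by
    calc Wᴴ * (W * cfc f B * Wᴴ + f c • (1 - W * Wᴴ)) * W
        = (Wᴴ * W) * cfc f B * (Wᴴ * W) + f c • (Wᴴ * W - (Wᴴ * W) * (Wᴴ * W)) := by
          simp only [Matrix.mul_add, Matrix.add_mul, Matrix.mul_smul, Matrix.smul_mul,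
            Matrix.mul_sub, Matrix.sub_mul, Matrix.mul_assoc, Matrix.mul_one]
      _ = cfc f B := by simp [hW]
  simpa only [e] using conj_mono' h W

/-- With `Tᴴ * T = 1 - Vᴴ * V`, the column `W` of `V` and `T` is an isometry, and the isometric case
applies to `A ⊕ ε`. -/
theorem IsOperatorMonotone.contraction_le_of_posDef (hf : IsOperatorMonotone f)
    (hf_pos : ∀ x : ℝ, 0 < x → 0 < f x) {V : Matrix k m ℂ} (hV : (1 - Vᴴ * V).PosSemidef)
    {A : Matrix k k ℂ} (hA : A.PosDef) {B : Matrix m m ℂ} (hB : B.PosDef)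
    (hBA : (B - Vᴴ * A * V).PosDef) : Vᴴ * cfc f A * V ≤ cfc f B := by
  obtain ⟨T, hT⟩ := CStarAlgebra.nonneg_iff_eq_star_mul_self.mp
    (Matrix.nonneg_iff_posSemidef.mpr hV)
  rw [Matrix.star_eq_conjTranspose] at hT
  -- The compression of `A ⊕ ε` is `Vᴴ * A * V + ε • (1 - Vᴴ * V)`; a small `ε` keeps it strictly
  -- below `B`.
  obtain ⟨ε, hε, hεB⟩ := exists_posDef_sub_smul hBA hV.1
  let J : Matrix (k ⊕ m) k ℂ := Matrix.fromRows 1 0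
  have hJH : Jᴴ = Matrix.fromCols 1 0 := by
    simp [J, Matrix.conjTranspose_fromRows_eq_fromCols_conjTranspose]
  have hJ : Jᴴ * J = 1 := by
    rw [hJH]; simp [J, Matrix.fromCols_mul_fromRows]
  have hJA : ∀ (Z : Matrix k k ℂ) (c : ℝ), J * Z * Jᴴ + c • (1 - J * Jᴴ)
      = Matrix.fromBlocks Z 0 0 (c • (1 : Matrix m m ℂ)) := by
    intro Z c
    rw [hJH]
    ext (i | i) (j | j) <;>
      simp [J, Matrix.fromRows_mul, Matrix.one_apply]
  let W : Matrix (k ⊕ m) m ℂ := Matrix.fromRows V T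
  have hWZ : ∀ (Z : Matrix k k ℂ) (c : ℝ), Wᴴ * (J * Z * Jᴴ + c • (1 - J * Jᴴ)) * W
      = Vᴴ * Z * V + c • (1 - Vᴴ * V) := by
    intro Z c
    rw [hJA, hT]
    simp [W, Matrix.conjTranspose_fromRows_eq_fromCols_conjTranspose,
      Matrix.fromCols_mul_fromRows, Matrix.fromCols_mul_fromBlocks]
  have hW : Wᴴ * W = 1 := by
    simp [W, Matrix.conjTranspose_fromRows_eq_fromCols_conjTranspose,
      Matrix.fromCols_mul_fromRows, ← hT]
  have h := hf.isometry_le hW (posDef_isometry_conj hJ hA hε) hB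
    (by rw [hWZ, ← sub_sub]; exact hεB)
  rw [cfc_isometry_conj f hJ hA.1 ε, hWZ] at h
  -- The extra term `f ε • (1 - Vᴴ * V)` is dropped because `f ε > 0`.
  refine le_trans ?_ h
  rw [Matrix.le_iff, add_sub_cancel_left]
  exact hV.smul (hf_pos ε hε).le

omit [DecidableEq m] in
theorem le_of_forall_smul_le {X Y : Matrix m m ℂ} (hX : X.IsHermitian) (hY : Y.IsHermitian)
    (h : ∀ c : ℝ, 0 < c → c < 1 → c • X ≤ Y) : X ≤ Y := by
  rw [Matrix.le_iff]
  refine Matrix.PosSemidef.of_dotProduct_mulVec_nonneg (hY.sub hX) fun x => ?_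
  have hlim : Filter.Tendsto (fun c : ℝ => star x ⬝ᵥ ((Y - c • X) *ᵥ x)) (nhdsWithin 1 (Set.Iio 1))
      (nhds (star x ⬝ᵥ ((Y - (1 : ℝ) • X) *ᵥ x))) := by
    refine Filter.Tendsto.mono_left (Continuous.tendsto ?_ 1) nhdsWithin_le_nhds
    simp only [Matrix.sub_mulVec, Matrix.smul_mulVec, dotProduct_sub, dotProduct_smul]
    fun_prop
  rw [one_smul] at hlim
  have := Complex.orderClosedTopology
  refine ge_of_tendsto hlim ?_
  filter_upwards [Ioo_mem_nhdsLT (zero_lt_one (α := ℝ))] with c hc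
  exact (Matrix.le_iff.mp (h c hc.1 hc.2)).dotProduct_mulVec_nonneg x

/-- Hansen's inequality in the form: if `V` is a contraction and `V† A V ≤ B` then
`V† f(A) V ≤ f(B)`. -/
theorem IsOperatorMonotone.contraction_le (hf : IsOperatorMonotone f)
    (hf_pos : ∀ x : ℝ, 0 < x → 0 < f x) {V : Matrix k m ℂ} (hV : Vᴴ * V ≤ 1)
    {A : Matrix k k ℂ} (hA : A.PosDef) {B : Matrix m m ℂ} (hB : B.PosDef)
    (hBA : Vᴴ * A * V ≤ B) : Vᴴ * cfc f A * V ≤ cfc f B := by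
  refine le_of_forall_smul_le (Matrix.isHermitian_conjTranspose_mul_mul V (isHermitian_cfc f A))
    (isHermitian_cfc f B) fun c hc0 hc1 => ?_
  -- Shrinking `V` to `√c • V` makes the hypothesis strict, with slack `(1 - c) • B`. The factor `c`
  -- stays outside `f`, so the limit `c → 1` needs no continuity of `f`.
  have hs : √c * √c = c := Real.mul_self_sqrt hc0.le
  have hconj : ∀ Z : Matrix k k ℂ, (√c • V)ᴴ * Z * (√c • V) = c • (Vᴴ * Z * V) := fun Z => by
    simp [Matrix.conjTranspose_smul, smul_smul, hs]
  rw [Matrix.le_iff] at hV hBA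
  rw [← hconj]
  refine hf.contraction_le_of_posDef hf_pos ?_ hA hB ?_
  · have h1 := hconj 1
    simp only [Matrix.mul_one] at h1
    rw [h1, show (1 : Matrix m m ℂ) - c • (Vᴴ * V) = (1 - c) • 1 + c • (1 - Vᴴ * V) by module]
    exact ((posDef_smul_one (sub_pos.mpr hc1)).posSemidef).add (hV.smul hc0.le)
  · rw [hconj, show B - c • (Vᴴ * A * V) = (1 - c) • B + c • (B - Vᴴ * A * V) by module]
    exact (hB.smul (sub_pos.mpr hc1)).add_posSemidef (hBA.smul hc0.le)

end OperatorMonotone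

/-! ### Transformer inequality and Schur-complement duality. -/

section Transformer

variable {a b : Type*} [Fintype a] [DecidableEq a] [Fintype b] [DecidableEq b]

/-- The transformer inequality for the operator mean of `S S` and `S D S`. -/
theorem IsOperatorMonotone.transformer_le {f : ℝ → ℝ} (hf : IsOperatorMonotone f)
    (hf_pos : ∀ x : ℝ, 0 < x → 0 < f x) {S D : Matrix a a ℂ} {S' D' : Matrix b b ℂ}
    (hS : S.PosDef) (hS' : S'.PosDef) (hD : D.PosDef) (hD' : D'.PosDef) {M : Matrix b a ℂ}
    (hR : M * (S * S) * Mᴴ ≤ S' * S') (hL : M * (S * D * S) * Mᴴ ≤ S' * D' * S') :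
    M * (S * cfc f D * S) * Mᴴ ≤ S' * cfc f D' * S' := by
  have hdet : IsUnit S'.det := (Matrix.isUnit_iff_isUnit_det _).mp hS'.isUnit
  have hinvH : S'⁻¹ᴴ = S'⁻¹ := hS'.inv.1.eq
  have h1 : S'⁻¹ * S' = 1 := Matrix.nonsing_inv_mul _ hdet
  have h2 : S' * S'⁻¹ = 1 := Matrix.mul_nonsing_inv _ hdet
  -- For `V = S * Mᴴ * S'⁻¹`, the hypotheses become `Vᴴ * V ≤ 1` and `Vᴴ * D * V ≤ D'`, as Hansen's
  -- inequality requires.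
  have hV : ∀ Z : Matrix a a ℂ, (S * Mᴴ * S'⁻¹)ᴴ * Z * (S * Mᴴ * S'⁻¹)
      = S'⁻¹ * (M * (S * Z * S) * Mᴴ) * S'⁻¹ := fun Z => by
    simp only [Matrix.conjTranspose_mul, Matrix.conjTranspose_conjTranspose, hinvH, hS.1.eq,
      Matrix.mul_assoc]
  have hc : ∀ Z : Matrix b b ℂ, S'⁻¹ * (S' * Z * S') * S'⁻¹ = Z := fun Z => by
    calc S'⁻¹ * (S' * Z * S') * S'⁻¹ = (S'⁻¹ * S') * Z * (S' * S'⁻¹) := by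
          simp only [Matrix.mul_assoc]
      _ = Z := by simp [h1, h2]
  have hc' : ∀ Z : Matrix b b ℂ, S' * (S'⁻¹ * Z * S'⁻¹) * S' = Z := fun Z => by
    calc S' * (S'⁻¹ * Z * S'⁻¹) * S' = (S' * S'⁻¹) * Z * (S'⁻¹ * S') := by
          simp only [Matrix.mul_assoc]
      _ = Z := by simp [h1, h2]
  have hmono : ∀ {Y Z : Matrix b b ℂ}, Y ≤ Z → S'⁻¹ * Y * S'⁻¹ ≤ S'⁻¹ * Z * S'⁻¹ := by
    intro Y Z h
    simpa only [hinvH] using conj_mono h S'⁻¹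
  have hRV : (S * Mᴴ * S'⁻¹)ᴴ * (S * Mᴴ * S'⁻¹) ≤ 1 := by
    have h := hmono hR
    have e := hc 1
    have e' := hV 1
    simp only [Matrix.mul_one] at e e'
    rwa [e, ← e'] at h
  have hLV : (S * Mᴴ * S'⁻¹)ᴴ * D * (S * Mᴴ * S'⁻¹) ≤ D' := by
    have h := hmono hL
    rwa [hc, ← hV] at h
  have h := hf.contraction_le hf_pos hRV hD hD' hLV
  rw [hV] at h
  have h' := conj_mono h S'
  rwa [hS'.1.eq, hc'] at h'

/-- Both sides are the Schur complement conditions for positivity of `[[K⁻¹, M†], [M, K']]`. -/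
theorem conj_le_iff_conj_inv_le {K : Matrix a a ℂ} {K' : Matrix b b ℂ} (hK : K.PosDef)
    (hK' : K'.PosDef) (M : Matrix b a ℂ) : M * K * Mᴴ ≤ K' ↔ Mᴴ * K'⁻¹ * M ≤ K⁻¹ := by
  have hi := hK.inv
  let := hi.isUnit.invertible
  let := hK'.isUnit.invertible
  have h1 := Matrix.PosDef.fromBlocks₁₁ Mᴴ K' hi
  have h2 := Matrix.PosDef.fromBlocks₂₂ K⁻¹ Mᴴ hK'
  rw [Matrix.nonsing_inv_nonsing_inv _ ((Matrix.isUnit_iff_isUnit_det _).mp hK.isUnit)] at h1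
  rw [Matrix.conjTranspose_conjTranspose] at h1 h2
  rw [Matrix.le_iff, Matrix.le_iff, ← h1, h2]

end Transformer

/-! ### Superoperators as matrices acting on `vec X`. -/

section Vectorization

variable {n p : Type*} [Fintype n] [DecidableEq n] [Fintype p] [DecidableEq p]

omit [Fintype n] [DecidableEq n] [Fintype p] [DecidableEq p] in
theorem sum_kronecker_sum {ι κ : Type*} (s : Finset ι) (t : Finset κ) (A : κ → Matrix n n ℂ)
    (B : ι → Matrix p p ℂ) :
    (∑ y ∈ t, A y) ⊗ₖ (∑ x ∈ s, B x) = ∑ z ∈ s ×ˢ t, A z.2 ⊗ₖ B z.1 := by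
  ext i j
  simp only [Matrix.sum_apply, Matrix.kroneckerMap_apply, Finset.sum_mul_sum]
  rw [Finset.sum_product, Finset.sum_comm]

omit [Fintype p] [DecidableEq p] in
theorem map_apply_eq_sum (E : Matrix n n ℂ →ₗ[ℂ] Matrix p p ℂ) (X : Matrix n n ℂ) (i j : p) :
    E X i j = ∑ a, ∑ b, X a b * E (Matrix.single a b 1) i j := by
  conv_lhs => rw [Matrix.matrix_eq_sum_single X]
  simp only [map_sum, Matrix.sum_apply]
  refine Finset.sum_congr rfl fun a _ => Finset.sum_congr rfl fun b _ => ?_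
  have h : Matrix.single a b (X a b) = X a b • Matrix.single a b (1 : ℂ) := by
    simp [Matrix.smul_single]
  rw [h, map_smul, Matrix.smul_apply, smul_eq_mul]

/-- The matrix of a superoperator with respect to vectorization. -/
def superMatrix (E : Matrix n n ℂ →ₗ[ℂ] Matrix p p ℂ) : Matrix (p × p) (n × n) ℂ :=
  Matrix.of fun i j => E (Matrix.single j.2 j.1 1) i.2 i.1

omit [Fintype p] [DecidableEq p] in
theorem superMatrix_mulVec_vec (E : Matrix n n ℂ →ₗ[ℂ] Matrix p p ℂ) (X : Matrix n n ℂ) :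
    superMatrix E *ᵥ vec X = vec (E X) := by
  ext i
  simp only [vec, Matrix.mulVec, dotProduct, superMatrix, Matrix.of_apply,
    Fintype.sum_prod_type, map_apply_eq_sum E X]
  rw [Finset.sum_comm]
  simp only [mul_comm]

/-- The matrix of `f(𝒟_{ρ,ρ})` with respect to vectorization. -/
def modularMatrix (f : ℝ → ℝ) (ρ : Matrix n n ℂ) : Matrix (n × n) (n × n) ℂ :=
  ∑ z ∈ realSpectrum ρ ×ˢ realSpectrum ρ,
    f (z.1 / z.2) • ((spectralProj ρ z.2)ᵀ ⊗ₖ spectralProj ρ z.1)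

theorem modularMatrix_mulVec_vec (f : ℝ → ℝ) (ρ X : Matrix n n ℂ) :
    modularMatrix f ρ *ᵥ vec X = vec (modularFun f ρ ρ X) := by
  rw [modularFun_apply, modularMatrix, Finset.sum_product, Matrix.vec_sum, Matrix.sum_mulVec]
  refine Finset.sum_congr rfl fun x _ => ?_
  rw [Matrix.vec_sum, Matrix.sum_mulVec]
  refine Finset.sum_congr rfl fun y _ => ?_
  rw [Matrix.smul_mulVec, Matrix.kronecker_mulVec_vec, Matrix.transpose_transpose,
    Matrix.vec_smul, Complex.coe_smul]

/-- The Kronecker products of spectral projections resolve the identity; ratios of different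
eigenvalue pairs may coincide. -/
theorem cfc_modularMatrix (f : ℝ → ℝ) {ρ : Matrix n n ℂ} (hρ : ρ.IsHermitian) :
    cfc f (modularMatrix (fun x => x) ρ) = modularMatrix f ρ := by
  unfold modularMatrix
  refine cfc_sum_smul f _ (fun z : ℝ × ℝ => z.1 / z.2)
    (fun z => (spectralProj ρ z.2)ᵀ ⊗ₖ spectralProj ρ z.1) ?_ ?_ ?_
  · intro z _
    rw [Matrix.IsHermitian, Matrix.conjTranspose_kronecker, (isHermitian_spectralProj ρ z.1).eq,
      (isHermitian_spectralProj ρ z.2).transpose.eq]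
  · rintro ⟨x, y⟩ _ ⟨x', y'⟩ _
    rw [← Matrix.mul_kronecker_mul, ← Matrix.transpose_mul, spectralProj_mul, spectralProj_mul]
    by_cases hx : x = x'
    · by_cases hy : y = y'
      · simp [hx, hy]
      · simp [hy, Ne.symm hy]
    · simp [hx]
  · have h := sum_spectralProj hρ
    have h' : ∑ x ∈ realSpectrum ρ, (spectralProj ρ x)ᵀ = 1 := by
      rw [← Matrix.transpose_sum, h, Matrix.transpose_one]
    exact (sum_kronecker_sum _ _ (fun y => (spectralProj ρ y)ᵀ) (spectralProj ρ)).symm.trans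
      (by rw [h, h', Matrix.one_kronecker_one])

theorem modularMatrix_id {ρ : Matrix n n ℂ} (hρ : ρ.PosDef) :
    modularMatrix (fun x => x) ρ = ρ⁻¹ᵀ ⊗ₖ ρ := by
  have hsa : IsSelfAdjoint ρ := hρ.1
  have hinv : ∑ x ∈ realSpectrum ρ, x⁻¹ • spectralProj ρ x = ρ⁻¹ := by
    refine (Matrix.inv_eq_left_inv ?_).symm
    rw [sum_smul_spectralProj ρ (fun x => x⁻¹)]
    conv_lhs => enter [2]; rw [← cfc_id' ℝ ρ hsa]
    rw [← cfc_mul _ _ ρ (continuousOn_spectrum ρ _) (continuousOn_spectrum ρ _),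
      ← cfc_const_one ℝ ρ hsa]
    refine cfc_congr fun x hx => ?_
    exact inv_mul_cancel₀ (pos_of_mem_realSpectrum hρ (by simpa [realSpectrum] using hx)).ne'
  have hself := sum_smul_spectralProj_self hρ.1
  calc modularMatrix (fun x => x) ρ
      = ∑ z ∈ realSpectrum ρ ×ˢ realSpectrum ρ,
          (z.2⁻¹ • spectralProj ρ z.2)ᵀ ⊗ₖ (z.1 • spectralProj ρ z.1) := by
        refine Finset.sum_congr rfl fun z _ => ?_
        rw [Matrix.transpose_smul, Matrix.smul_kronecker, Matrix.kronecker_smul, smul_smul,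
          div_eq_inv_mul]
    _ = ρ⁻¹ᵀ ⊗ₖ ρ := by
        exact (sum_kronecker_sum _ _ (fun y => (y⁻¹ • spectralProj ρ y)ᵀ)
          (fun x => x • spectralProj ρ x)).symm.trans
          (by rw [← Matrix.transpose_sum, hinv, hself])

theorem posDef_modularMatrix_id {ρ : Matrix n n ℂ} (hρ : ρ.PosDef) :
    (modularMatrix (fun x => x) ρ).PosDef := by
  rw [modularMatrix_id hρ]
  exact hρ.inv.transpose.kronecker hρ

/-- The matrix of `ℛ_{√ρ}` with respect to vectorization. -/
def sqrtMatrix (ρ : Matrix n n ℂ) : Matrix (n × n) (n × n) ℂ :=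
  (cfc Real.sqrt ρ)ᵀ ⊗ₖ (1 : Matrix n n ℂ)

theorem posDef_sqrtMatrix {ρ : Matrix n n ℂ} (hρ : ρ.PosDef) : (sqrtMatrix ρ).PosDef :=
  (posDef_cfc hρ fun _ => Real.sqrt_pos.mpr).transpose.kronecker Matrix.PosDef.one

theorem sqrtMatrix_mul_self {ρ : Matrix n n ℂ} (hρ : ρ.PosDef) :
    sqrtMatrix ρ * sqrtMatrix ρ = ρᵀ ⊗ₖ (1 : Matrix n n ℂ) := by
  have hsa : IsSelfAdjoint ρ := hρ.1
  have h : cfc Real.sqrt ρ * cfc Real.sqrt ρ = ρ := by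
    rw [← cfc_mul _ _ ρ (continuousOn_spectrum ρ _) (continuousOn_spectrum ρ _)]
    conv_rhs => rw [← cfc_id' ℝ ρ hsa]
    refine cfc_congr fun x hx => ?_
    exact Real.mul_self_sqrt (pos_of_mem_realSpectrum hρ (by simpa [realSpectrum] using hx)).le
  rw [sqrtMatrix, ← Matrix.mul_kronecker_mul, ← Matrix.transpose_mul, h, Matrix.one_mul]

/-- Lets `f(𝒟) ℛ_ρ` be written symmetrically as `S f(𝒟) S`, which is manifestly positive definite.
-/
theorem commute_sqrtMatrix_modularMatrix (f : ℝ → ℝ) (ρ : Matrix n n ℂ) :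
    Commute (sqrtMatrix ρ) (modularMatrix f ρ) := by
  refine Commute.sum_right _ _ _ fun z _ => Commute.smul_right ?_ _
  have h : Commute (cfc Real.sqrt ρ) (spectralProj ρ z.2) := cfc_commute_cfc _ _ ρ
  rw [Commute, SemiconjBy, sqrtMatrix, ← Matrix.mul_kronecker_mul, ← Matrix.mul_kronecker_mul,
    ← Matrix.transpose_mul, ← Matrix.transpose_mul, h.eq, Matrix.one_mul, Matrix.mul_one]

/-- The matrix of `𝒦_ρ` with respect to vectorization. -/
def fisherOpMatrix (f : ℝ → ℝ) (ρ : Matrix n n ℂ) : Matrix (n × n) (n × n) ℂ :=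
  sqrtMatrix ρ * cfc f (modularMatrix (fun x => x) ρ) * sqrtMatrix ρ

theorem fisherOpMatrix_eq (f : ℝ → ℝ) {ρ : Matrix n n ℂ} (hρ : ρ.PosDef) :
    fisherOpMatrix f ρ = modularMatrix f ρ * (ρᵀ ⊗ₖ (1 : Matrix n n ℂ)) := by
  rw [fisherOpMatrix, cfc_modularMatrix f hρ.1, (commute_sqrtMatrix_modularMatrix f ρ).eq,
    Matrix.mul_assoc, sqrtMatrix_mul_self hρ]

/-- The endpoint `ℒ_ρ` of the mean; `sqrtMatrix_mul_self` gives the other endpoint `ℛ_ρ`. -/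
theorem sqrtMatrix_mul_modularMatrix_mul_sqrtMatrix {ρ : Matrix n n ℂ} (hρ : ρ.PosDef) :
    sqrtMatrix ρ * modularMatrix (fun x => x) ρ * sqrtMatrix ρ
      = (1 : Matrix n n ℂ) ⊗ₖ ρ := by
  rw [(commute_sqrtMatrix_modularMatrix _ ρ).eq, Matrix.mul_assoc, sqrtMatrix_mul_self hρ,
    modularMatrix_id hρ, ← Matrix.mul_kronecker_mul, ← Matrix.transpose_mul,
    Matrix.mul_nonsing_inv _ ((Matrix.isUnit_iff_isUnit_det _).mp hρ.isUnit)]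
  simp

theorem posDef_fisherOpMatrix {f : ℝ → ℝ} (hf : ∀ x : ℝ, 0 < x → 0 < f x) {ρ : Matrix n n ℂ}
    (hρ : ρ.PosDef) : (fisherOpMatrix f ρ).PosDef := by
  have hS := posDef_sqrtMatrix hρ
  have h := (Matrix.IsUnit.posDef_star_left_conjugate_iff hS.isUnit).mpr
    (posDef_cfc (posDef_modularMatrix_id hρ) hf)
  rwa [Matrix.star_eq_conjTranspose, hS.1.eq] at h

theorem fisherOpMatrix_mulVec_vec (f : ℝ → ℝ) {ρ : Matrix n n ℂ} (hρ : ρ.PosDef)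
    (X : Matrix n n ℂ) : fisherOpMatrix f ρ *ᵥ vec X = vec (fisherOp f ρ X) := by
  rw [fisherOpMatrix_eq f hρ, ← Matrix.mulVec_mulVec, Matrix.kronecker_mulVec_vec,
    modularMatrix_mulVec_vec]
  simp [fisherOp]

theorem fisherMetric_eq {f : ℝ → ℝ} (hf : ∀ x : ℝ, 0 < x → 0 < f x) {ρ : Matrix n n ℂ}
    (hρ : ρ.PosDef) (X Y : Matrix n n ℂ) :
    fisherMetric f ρ X Y = star (vec X) ⬝ᵥ ((fisherOpMatrix f ρ)⁻¹ *ᵥ vec Y) := by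
  -- `Ring.inverse` is zero on non-units, so invertibility of `𝒦_ρ` is needed here.
  have hinv : fisherOp f ρ (Ring.inverse (fisherOp f ρ) Y) = Y := by
    rw [← Module.End.mul_apply, Ring.mul_inverse_cancel _ (isUnit_fisherOp hf hρ),
      Module.End.one_apply]
  have hdet : IsUnit (fisherOpMatrix f ρ).det :=
    (Matrix.isUnit_iff_isUnit_det _).mp (posDef_fisherOpMatrix hf hρ).isUnit
  have h : (fisherOpMatrix f ρ)⁻¹ *ᵥ vec Y = vec (Ring.inverse (fisherOp f ρ) Y) := by
    conv_lhs => rw [← hinv, ← fisherOpMatrix_mulVec_vec f hρ]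
    rw [Matrix.mulVec_mulVec, Matrix.nonsing_inv_mul _ hdet, Matrix.one_mulVec]
  rw [h, Matrix.star_vec_dotProduct_vec, fisherMetric, hsInner]

end Vectorization

/-! ### Schwarz inequality for 2-positive maps and monotonicity of the metric. -/

section TwoPositive

variable {n p : Type*} [Fintype n] [DecidableEq n] [Fintype p] [DecidableEq p]
variable {E : Matrix n n ℂ →ₗ[ℂ] Matrix p p ℂ}

omit [Fintype n] [DecidableEq n] [Fintype p] [DecidableEq p] in
theorem IsNPositive.fromBlocks (hE : IsNPositive 2 E) {A B C D : Matrix n n ℂ}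
    (h : (Matrix.fromBlocks A B C D).PosSemidef) :
    (Matrix.fromBlocks (E A) (E B) (E C) (E D)).PosSemidef := by
  let e : n × Fin 2 → n ⊕ n := fun i => if i.2 = 0 then Sum.inl i.1 else Sum.inr i.1
  have h1 := (hE _ (h.submatrix e)).submatrix
    (Sum.elim (fun i => (i, 0)) (fun i => (i, 1)) : p ⊕ p → p × Fin 2)
  convert h1 using 1
  ext (i | i) (j | j) <;> rfl

/-- The Schur complement of `ρ` in this block matrix is zero. -/
theorem posSemidef_fromBlocks_of_posDef {ρ : Matrix n n ℂ} (hρ : ρ.PosDef) (X : Matrix n n ℂ) :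
    (Matrix.fromBlocks ρ X Xᴴ (Xᴴ * ρ⁻¹ * X)).PosSemidef := by
  let := hρ.isUnit.invertible
  rw [Matrix.PosDef.fromBlocks₁₁ _ _ hρ, sub_self]
  exact Matrix.PosSemidef.zero

omit [Fintype p] [DecidableEq p] in
theorem IsNPositive.map_conjTranspose (hE : IsNPositive 2 E) (X : Matrix n n ℂ) :
    E Xᴴ = (E X)ᴴ := by
  have h := (hE.fromBlocks (posSemidef_fromBlocks_of_posDef Matrix.PosDef.one X)).1
  exact ((Matrix.isHermitian_fromBlocks_iff.mp h).2.1).symm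

/-- The Lieb–Ruskai form of the Schwarz inequality for 2-positive maps. -/
theorem IsNPositive.schwarz (hE : IsNPositive 2 E) {ρ : Matrix n n ℂ} (hρ : ρ.PosDef)
    (hEρ : (E ρ).PosDef) (X : Matrix n n ℂ) :
    (E X)ᴴ * (E ρ)⁻¹ * E X ≤ E (Xᴴ * ρ⁻¹ * X) := by
  have h := hE.fromBlocks (posSemidef_fromBlocks_of_posDef hρ X)
  let := hEρ.isUnit.invertible
  rw [hE.map_conjTranspose, Matrix.PosDef.fromBlocks₁₁ _ _ hEρ] at h
  exact h

theorem IsNPositive.trace_schwarz (hE : IsNPositive 2 E) (hTP : IsTracePreserving E)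
    {ρ : Matrix n n ℂ} (hρ : ρ.PosDef) (hEρ : (E ρ).PosDef) (X : Matrix n n ℂ) :
    ((E X)ᴴ * (E ρ)⁻¹ * E X).trace ≤ (Xᴴ * ρ⁻¹ * X).trace := by
  have h := (Matrix.le_iff.mp (hE.schwarz hρ hEρ X)).trace_nonneg
  rw [Matrix.trace_sub, hTP] at h
  exact sub_nonneg.mp h

/-- Schur duality reduces the claim to quadratic forms of inverses, and every vector is some `vec
X`. -/
theorem superMatrix_conj_le {T : Matrix (n × n) (n × n) ℂ} {T' : Matrix (p × p) (p × p) ℂ}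
    (hT : T.PosDef) (hT' : T'.PosDef)
    (h : ∀ X : Matrix n n ℂ, star (vec (E X)) ⬝ᵥ (T'⁻¹ *ᵥ vec (E X))
      ≤ star (vec X) ⬝ᵥ (T⁻¹ *ᵥ vec X)) :
    superMatrix E * T * (superMatrix E)ᴴ ≤ T' := by
  rw [conj_le_iff_conj_inv_le hT hT', Matrix.le_iff]
  refine Matrix.PosSemidef.of_dotProduct_mulVec_nonneg
    (hT.inv.1.sub (Matrix.isHermitian_conjTranspose_mul_mul _ hT'.inv.1)) fun x => ?_
  obtain ⟨X, rfl⟩ := Matrix.vec_bijective.2 x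
  rw [Matrix.sub_mulVec, dotProduct_sub, sub_nonneg, ← Matrix.mulVec_mulVec,
    ← Matrix.mulVec_mulVec, Matrix.dotProduct_mulVec _ (superMatrix E)ᴴ, ← Matrix.star_mulVec,
    superMatrix_mulVec_vec]
  exact h X

theorem IsNPositive.superMatrix_conj_left_le (hE : IsNPositive 2 E) (hTP : IsTracePreserving E)
    {ρ : Matrix n n ℂ} (hρ : ρ.PosDef) (hEρ : (E ρ).PosDef) :
    superMatrix E * ((1 : Matrix n n ℂ) ⊗ₖ ρ) * (superMatrix E)ᴴ ≤ (1 : Matrix p p ℂ) ⊗ₖ E ρ := by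
  refine superMatrix_conj_le (Matrix.PosDef.one.kronecker hρ) (Matrix.PosDef.one.kronecker hEρ)
    fun X => ?_
  rw [Matrix.inv_kronecker, Matrix.inv_kronecker, Matrix.kronecker_mulVec_vec,
    Matrix.kronecker_mulVec_vec, Matrix.star_vec_dotProduct_vec, Matrix.star_vec_dotProduct_vec]
  simpa [Matrix.mul_assoc] using hE.trace_schwarz hTP hρ hEρ X

theorem IsNPositive.superMatrix_conj_right_le (hE : IsNPositive 2 E) (hTP : IsTracePreserving E)
    {ρ : Matrix n n ℂ} (hρ : ρ.PosDef) (hEρ : (E ρ).PosDef) :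
    superMatrix E * (ρᵀ ⊗ₖ (1 : Matrix n n ℂ)) * (superMatrix E)ᴴ
      ≤ (E ρ)ᵀ ⊗ₖ (1 : Matrix p p ℂ) := by
  refine superMatrix_conj_le (hρ.transpose.kronecker Matrix.PosDef.one)
    (hEρ.transpose.kronecker Matrix.PosDef.one) fun X => ?_
  rw [Matrix.inv_kronecker, Matrix.inv_kronecker, Matrix.kronecker_mulVec_vec,
    Matrix.kronecker_mulVec_vec, Matrix.star_vec_dotProduct_vec, Matrix.star_vec_dotProduct_vec]
  -- Right multiplication is handled by the Schwarz inequality at `Xᴴ` and cyclicity of the trace.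
  have h := hE.trace_schwarz hTP hρ hEρ Xᴴ
  rw [hE.map_conjTranspose, Matrix.conjTranspose_conjTranspose, Matrix.conjTranspose_conjTranspose,
    Matrix.trace_mul_comm, Matrix.trace_mul_comm (X * ρ⁻¹)] at h
  simpa [← Matrix.transpose_nonsing_inv] using h

/-- Monotonicity of the inverse Fisher superoperator under 2-positive trace-preserving maps. -/
theorem conj_fisherOpMatrix_inv_le {f : ℝ → ℝ} (hf_pos : ∀ x : ℝ, 0 < x → 0 < f x)
    (hf : IsOperatorMonotone f) (hE : IsNPositive 2 E) (hTP : IsTracePreserving E)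
    {ρ : Matrix n n ℂ} (hρ : ρ.PosDef) (hEρ : (E ρ).PosDef) :
    (superMatrix E)ᴴ * (fisherOpMatrix f (E ρ))⁻¹ * superMatrix E ≤ (fisherOpMatrix f ρ)⁻¹ := by
  rw [← conj_le_iff_conj_inv_le (posDef_fisherOpMatrix hf_pos hρ)
    (posDef_fisherOpMatrix hf_pos hEρ)]
  refine hf.transformer_le hf_pos (posDef_sqrtMatrix hρ) (posDef_sqrtMatrix hEρ)
    (posDef_modularMatrix_id hρ) (posDef_modularMatrix_id hEρ) ?_ ?_
  · rw [sqrtMatrix_mul_self hρ, sqrtMatrix_mul_self hEρ]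
    exact hE.superMatrix_conj_right_le hTP hρ hEρ
  · rw [sqrtMatrix_mul_modularMatrix_mul_sqrtMatrix hρ,
      sqrtMatrix_mul_modularMatrix_mul_sqrtMatrix hEρ]
    exact hE.superMatrix_conj_left_le hTP hρ hEρ

/-- The Gram matrix of a family of operators in the Fisher metric. -/
theorem of_fisherMetric_eq {ι : Type*} {f : ℝ → ℝ} (hf : ∀ x : ℝ, 0 < x → 0 < f x)
    {ρ : Matrix n n ℂ} (hρ : ρ.PosDef) (X : ι → Matrix n n ℂ) :
    (Matrix.of fun k l => fisherMetric f ρ (X k) (X l))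
      = (Matrix.of fun i k => vec (X k) i)ᴴ * (fisherOpMatrix f ρ)⁻¹
        * Matrix.of fun i k => vec (X k) i := by
  ext k l
  rw [Matrix.of_apply, fisherMetric_eq hf hρ, Matrix.mul_assoc, Matrix.mul_apply_eq_vecMul,
    Matrix.vecMul, dotProduct, dotProduct]
  rfl

theorem posSemidef_of_fisherMetric {ι : Type*} [Fintype ι] {f : ℝ → ℝ}
    (hf : ∀ x : ℝ, 0 < x → 0 < f x) {ρ : Matrix n n ℂ} (hρ : ρ.PosDef) (X : ι → Matrix n n ℂ) :
    (Matrix.of fun k l => fisherMetric f ρ (X k) (X l)).PosSemidef := by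
  rw [of_fisherMetric_eq hf hρ]
  exact (posDef_fisherOpMatrix hf hρ).inv.posSemidef.conjTranspose_mul_mul_same _

/-- Serves both claims: a one-point `ι` gives the metric inequality, `ι = Fin m` with the partial
derivatives gives the matrix inequality. -/
theorem of_fisherMetric_map_le {ι : Type*} [Fintype ι] {f : ℝ → ℝ}
    (hf_pos : ∀ x : ℝ, 0 < x → 0 < f x) (hf : IsOperatorMonotone f) (hE : IsNPositive 2 E)
    (hTP : IsTracePreserving E) {ρ : Matrix n n ℂ} (hρ : ρ.PosDef) (hEρ : (E ρ).PosDef)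
    (X : ι → Matrix n n ℂ) :
    (Matrix.of fun k l => fisherMetric f (E ρ) (E (X k)) (E (X l)))
      ≤ Matrix.of fun k l => fisherMetric f ρ (X k) (X l) := by
  have hcol : (Matrix.of fun i k => vec (E (X k)) i)
      = superMatrix E * Matrix.of fun i k => vec (X k) i := by
    ext i k
    rw [Matrix.of_apply, ← superMatrix_mulVec_vec]
    rfl
  rw [of_fisherMetric_eq hf_pos hEρ fun k => E (X k), of_fisherMetric_eq hf_pos hρ, hcol]
  have h := conj_mono' (conj_fisherOpMatrix_inv_le hf_pos hf hE hTP hρ hEρ)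
    (Matrix.of fun i k => vec (X k) i)
  simpa only [Matrix.conjTranspose_mul, Matrix.mul_assoc] using h

-- Each entry of `E (ρ t)` is a fixed linear combination of the entries of `ρ t`.
omit [Fintype p] [DecidableEq p] in
theorem partialDeriv_map {m : ℕ} (E : Matrix n n ℂ →ₗ[ℂ] Matrix p p ℂ)
    {ρ : (Fin m → ℝ) → Matrix n n ℂ} {θ : Fin m → ℝ}
    (hρ : ∀ i j, DifferentiableAt ℝ (fun t => ρ t i j) θ) (k : Fin m) :
    partialDeriv (fun t => E (ρ t)) k θ = E (partialDeriv ρ k θ) := by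
  ext i j
  rw [map_apply_eq_sum]
  simp only [partialDeriv, Matrix.of_apply]
  simp_rw [map_apply_eq_sum E (ρ _) i j]
  have hd : HasFDerivAt (fun t => ∑ a, ∑ b, ρ t a b * E (Matrix.single a b 1) i j)
      (∑ a, ∑ b, (E (Matrix.single a b 1) i j) • fderiv ℝ (fun t => ρ t a b) θ) θ :=
    HasFDerivAt.fun_sum fun a _ => HasFDerivAt.fun_sum fun b _ =>
      (hρ a b).hasFDerivAt.mul_const _
  rw [hd.fderiv]
  simp [mul_comm]

end TwoPositive

end QFisher

end

open QFisher
theorem mainTheorem9 {n p : Type*} [Fintype n] [DecidableEq n] [Fintype p] [DecidableEq p]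
    (f : ℝ → ℝ) (hf_pos : ∀ x : ℝ, 0 < x → 0 < f x) (hf : IsOperatorMonotone f)
    (E : Matrix n n ℂ →ₗ[ℂ] Matrix p p ℂ) (hE : IsNPositive 2 E) (hTP : IsTracePreserving E) :
    (∀ ρ : Matrix n n ℂ, IsPosDefState ρ → IsPosDefState (E ρ) → ∀ X : Matrix n n ℂ,
      (fisherMetric f ρ X X).im = 0 ∧ (fisherMetric f (E ρ) (E X) (E X)).im = 0 ∧
        (fisherMetric f (E ρ) (E X) (E X)).re ≤ (fisherMetric f ρ X X).re) ∧
    (∀ (m : ℕ) (Θ : Set (Fin m → ℝ)) (ρ : (Fin m → ℝ) → Matrix n n ℂ),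
      IsOpen Θ → IsSmoothOn ρ Θ →
      (∀ θ ∈ Θ, IsPosDefState (ρ θ)) → (∀ θ ∈ Θ, IsPosDefState (E (ρ θ))) →
      ∀ θ ∈ Θ, (fisherMatrix f ρ θ - fisherMatrix f (fun t => E (ρ t)) θ).PosSemidef) := by
  constructor
  · intro ρ hρ hEρ X
    have him : ∀ {z : ℂ}, 0 ≤ z → z.im = 0 := fun h => (Complex.nonneg_iff.mp h).2.symm
    have h := (of_fisherMetric_map_le hf_pos hf hE hTP hρ.1 hEρ.1 fun _ : Unit => X)
    refine ⟨him ((posSemidef_of_fisherMetric hf_pos hρ.1 fun _ : Unit => X).diag_nonneg (i := ())),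
      him ((posSemidef_of_fisherMetric hf_pos hEρ.1 fun _ : Unit => E X).diag_nonneg (i := ())),
      ?_⟩
    have h' := (Complex.nonneg_iff.mp ((Matrix.le_iff.mp h).diag_nonneg (i := ()))).1
    simpa using h'
  · intro m Θ ρ hΘ hsm hρ hEρ θ hθ
    have hd : ∀ i j, DifferentiableAt ℝ (fun t => ρ t i j) θ := fun i j =>
      ((hsm i j).contDiffAt (hΘ.mem_nhds hθ)).differentiableAt (by simp)
    have h := of_fisherMetric_map_le hf_pos hf hE hTP (hρ θ hθ).1 (hEρ θ hθ).1
      fun k => partialDeriv ρ k θ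
    rw [Matrix.le_iff] at h
    simpa only [fisherMatrix, partialDeriv_map E hd] using h
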